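/- Let $n\ge 0$, let $\alpha>0$ and $\varepsilon_1,\dots,\varepsilon_n>0$ be constants, and let $W_1,\dots,W_n$ be independent standard scalar Brownian motions on a probability space. For $i=1,\dots,n$ let $X_i$ be the Ornstein--Uhlenbeck process with continuous paths solving $$dX_i(t)=-\alpha X_i(t)\,dt+\varepsilon_i\,dW_i(t),\qquad X_i(0)=0,\qquad t\ge 0,$$ that is, almost surely $X_i(t)=-\alpha\int_0^t X_i(s)\,ds+\varepsilon_iW_i(t)$ for all $t\ge0$. For the reference node $0$ put $\varepsilon_0=0$ and $X_0\equiv 0$. For $0\le i,j\le n$ and $t\ge 0$ let $$c_i(t)=e^{-\frac14\frac{\varepsilon_i^2}{\alpha}(1-e^{-2\alpha t})},\quad a_i(t)=c_i(t)e^{X_i(t)},\quad X_{ij}(t)=X_j(t)-X_i(t),\quad a_{ij}(t)=\frac{a_j(t)}{a_i(t)}.$$ Call a real process $(Y(t))_{t\ge0}$ $L^p$-bounded if $\sup_{t\ge 0}\mathbb E[|Y(t)|^p]<\infty$. Then for every real $p\ge 1$ and all $i,j\in\{0,1,\dots,n\}$: the processes $X_i$ and $X_{ij}$ are $L^p$-bounded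 Gaussian processes (with degenerate Gaussian laws allowed), and the processes $a_i$, $a_{ij}$, $1/a_i$ and $1/a_{ij}$ are $L^p$-bounded. -/

import Mathlib

open MeasureTheory ProbabilityTheory
open scoped NNReal ENNReal

noncomputable section

/-- `X` is a solution, driven by `W`, of the Ornstein-Uhlenbeck equation
`dX(t) = -α X(t) dt + ε dW(t)`, `X(0) = 0`: it has almost surely continuous paths, and almost surely
`X(t) = -α ∫₀ᵗ X(s) ds + ε W(t)` for all `t ≥ 0`. (The noise is additive, so this integral form
contains no stochastic integral.) -/
structure IsOrnsteinUhlenbeck {Ω : Type*} [MeasurableSpace Ω] (α ε : ℝ)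
    (W X : ℝ≥0 → Ω → ℝ) (P : Measure Ω) : Prop where
  cont : ∀ᵐ ω ∂P, Continuous (fun t => X t ω)
  init : ∀ᵐ ω ∂P, X 0 ω = 0
  sde : ∀ᵐ ω ∂P, ∀ t : ℝ≥0,
    X t ω = -α * (∫ s in (0 : ℝ)..(t : ℝ), X s.toNNReal ω) + ε * W t ω

/-- A real process is `L^p`-bounded: each `Y t` is in `L^p`, with norms bounded uniformly in `t`. -/
def IsLpBounded {Ω T : Type*} [MeasurableSpace Ω] (Y : T → Ω → ℝ) (p : ℝ≥0∞)
    (P : Measure Ω) : Prop :=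
  (∀ t, AEStronglyMeasurable (Y t) P) ∧ ∃ C : ℝ≥0, ∀ t, eLpNorm (Y t) p P ≤ C

/-- The noise intensities of all `n + 1` nodes: `0` for the reference node `0`, and `ε i` for the
`i`-th of the other `n` nodes. -/
def nodeNoise {n : ℕ} (ε : Fin n → ℝ) : Fin (n + 1) → ℝ :=
  Fin.cons 0 ε

/-- The processes `X_i` of all `n + 1` nodes: `X_0 = 0` for the reference node. -/
def nodeState {Ω : Type*} {n : ℕ} (X : Fin n → ℝ≥0 → Ω → ℝ) : Fin (n + 1) → ℝ≥0 → Ω → ℝ :=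
  Fin.cons (fun _ _ => 0) X

/-- `c_i(t) = exp(-(1/4) (ε_i² / α) (1 - exp(-2 α t)))`. -/
def skewCoeff {n : ℕ} (α : ℝ) (ε : Fin n → ℝ) (i : Fin (n + 1)) (t : ℝ≥0) : ℝ :=
  Real.exp (-(1 / 4) * (nodeNoise ε i ^ 2 / α) * (1 - Real.exp (-2 * α * (t : ℝ))))

/-- The skew `a_i(t) = c_i(t) exp(X_i(t))`. -/
def skew {Ω : Type*} {n : ℕ} (α : ℝ) (ε : Fin n → ℝ) (X : Fin n → ℝ≥0 → Ω → ℝ)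
    (i : Fin (n + 1)) (t : ℝ≥0) (ω : Ω) : ℝ :=
  skewCoeff α ε i t * Real.exp (nodeState X i t ω)

/-- The relative process `X_ij(t) = X_j(t) - X_i(t)`. -/
def relState {Ω : Type*} {n : ℕ} (X : Fin n → ℝ≥0 → Ω → ℝ) (i j : Fin (n + 1))
    (t : ℝ≥0) (ω : Ω) : ℝ :=
  nodeState X j t ω - nodeState X i t ω

/-- The relative skew `a_ij(t) = a_j(t) / a_i(t)`. -/
def relSkew {Ω : Type*} {n : ℕ} (α : ℝ) (ε : Fin n → ℝ) (X : Fin n → ℝ≥0 → Ω → ℝ)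
    (i j : Fin (n + 1)) (t : ℝ≥0) (ω : Ω) : ℝ :=
  skew α ε X j t ω / skew α ε X i t ω

end

open Filter Topology

/-! The noise is additive, so the equation can be solved path by path with the implicit Euler
scheme, whose values are finite linear combinations of values of `W`, hence centered and jointly
Gaussian across independent drivers. Continuity of the paths makes the scheme converge
(`tendsto_implicitEuler`), and almost sure limits preserve centered Gaussianity. The scheme has
variance at most `ε² / (2α)` for every step size and time, and this bound passes to the limit. Every
skew or relative skew is the exponential of a bounded deterministic term plus a centered Gaussian
variable of bounded variance, so the Gaussian moment generating function bounds its `p`-th moment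
uniformly in time. Reciprocals only swap the two nodes, and node `0` turns single-node claims into
relative ones. -/

namespace ProbabilityTheory

/-! ### Gaussian processes: almost sure limits and independence -/

section GaussianLimit

variable {Ω : Type*} {mΩ : MeasurableSpace Ω} {P : Measure Ω}

/-- An almost sure limit of centered real Gaussian variables is centered Gaussian, and the
variances converge to that of the limit. -/
theorem exists_hasLaw_gaussianReal_of_tendsto_ae {Y : ℕ → Ω → ℝ} {Z : Ω → ℝ}
    (hY : ∀ m, HasGaussianLaw (Y m) P) (hmean : ∀ m, P[Y m] = 0)
    (hlim : ∀ᵐ ω ∂P, Tendsto (fun m ↦ Y m ω) atTop (𝓝 (Z ω))) :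
    ∃ v : ℝ≥0, Tendsto (fun m ↦ Var[Y m; P]) atTop (𝓝 v) ∧ HasLaw Z (gaussianReal 0 v) P := by
  have : IsProbabilityMeasure P := (hY 0).isProbabilityMeasure
  have hZ : AEMeasurable Z P :=
    aemeasurable_of_tendsto_metrizable_ae' (fun m ↦ (hY m).aemeasurable) hlim
  have : IsProbabilityMeasure (P.map Z) := Measure.isProbabilityMeasure_map hZ
  have hchar (m : ℕ) (t : ℝ) :
      charFun (P.map (Y m)) t = Complex.exp (-(Var[Y m; P] * t ^ 2 / 2)) := by
    rw [(hY m).map_eq_gaussianReal, charFun_gaussianReal, hmean m,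
      Real.coe_toNNReal _ (variance_nonneg _ _)]
    simp
  have hconv (t : ℝ) : Tendsto (fun m ↦ charFun (P.map (Y m)) t) atTop
      (𝓝 (charFun (P.map Z) t)) := by
    have h {U : Ω → ℝ} (hU : AEMeasurable U P) :
        charFun (P.map U) t = ∫ ω, Complex.exp (t * U ω * Complex.I) ∂P := by
      rw [charFun_apply_real, integral_map hU (by fun_prop)]
    simp_rw [h hZ, fun m ↦ h (hY m).aemeasurable]
    refine tendsto_integral_of_dominated_convergence (fun _ ↦ 1) (fun m ↦ ?_)
      (integrable_const _) (fun m ↦ ?_) ?_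
    · have := (hY m).aemeasurable
      exact AEMeasurable.aestronglyMeasurable (by fun_prop)
    · refine ae_of_all _ fun ω ↦ ?_
      rw [← Complex.ofReal_mul, Complex.norm_exp_ofReal_mul_I]
    · filter_upwards [hlim] with ω hω
      have hc : Continuous fun x : ℝ ↦ Complex.exp (t * x * Complex.I) := by fun_prop
      exact (hc.tendsto _).comp hω
  -- At one `t ≠ 0` where the limit does not vanish, the logarithm of the modulus recovers the
  -- variances and forces them to converge.
  obtain ⟨t, ht0, ht⟩ : ∃ t : ℝ, t ≠ 0 ∧ charFun (P.map Z) t ≠ 0 := by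
    have hcont : ContinuousAt (charFun (P.map Z)) 0 := continuous_charFun.continuousAt
    have h0 : charFun (P.map Z) 0 ≠ 0 := by simp
    have h1 := (hcont.eventually_ne h0).filter_mono (nhdsWithin_le_nhds (s := {0}ᶜ))
    obtain ⟨t, h2, h3⟩ := (h1.and self_mem_nhdsWithin).exists
    exact ⟨t, h3, h2⟩
  have hvar : Tendsto (fun m ↦ Var[Y m; P]) atTop
      (𝓝 (-(2 * Real.log ‖charFun (P.map Z) t‖ / t ^ 2))) := by
    have h := ((hconv t).norm.log (norm_ne_zero_iff.2 ht)).const_mul 2 |>.div_const (t ^ 2) |>.neg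
    refine h.congr fun m ↦ ?_
    have : -((Var[Y m; P] : ℂ) * t ^ 2 / 2) = ((-(Var[Y m; P] * t ^ 2 / 2) : ℝ) : ℂ) := by
      push_cast; ring
    rw [hchar, this, Complex.norm_exp_ofReal, Real.log_exp]
    field_simp
  have hnonneg := ge_of_tendsto' hvar fun m ↦ variance_nonneg (Y m) P
  lift -(2 * Real.log ‖charFun (P.map Z) t‖ / t ^ 2) to ℝ≥0 using hnonneg with v hv
  refine ⟨v, hvar, hZ, Measure.ext_of_charFun ?_⟩
  ext s
  refine tendsto_nhds_unique (hconv s) ?_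
  simp_rw [hchar, charFun_gaussianReal]
  have hc : Continuous fun x : ℝ ↦ Complex.exp (-(x * s ^ 2 / 2)) := by fun_prop
  simpa [Function.comp_def] using (hc.tendsto _).comp hvar

variable {S T : Type*}

/-- A process whose values are linear combinations of values of a real Gaussian process is
Gaussian. -/
theorem IsGaussianProcess.of_mem_span {X : T → Ω → ℝ} {Y : S → Ω → ℝ}
    (hX : IsGaussianProcess X P) (h : ∀ s, Y s ∈ Submodule.span ℝ (Set.range X)) :
    IsGaussianProcess Y P := by
  refine hX.of_isGaussianProcess fun s ↦ ?_
  obtain ⟨c, hc⟩ := Finsupp.mem_span_range_iff_exists_finsupp.1 (h s)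
  refine ⟨c.support, ∑ t : c.support, c t • ContinuousLinearMap.proj t, fun ω ↦ ?_⟩
  rw [← hc, Finsupp.sum, ← Finset.sum_coe_sort]
  simp

theorem IsGaussianProcess.integral_eq_zero_of_mem_span {X : T → Ω → ℝ} {Y : Ω → ℝ}
    (hX : IsGaussianProcess X P) (hmean : ∀ t, P[X t] = 0)
    (h : Y ∈ Submodule.span ℝ (Set.range X)) : P[Y] = 0 := by
  obtain ⟨c, rfl⟩ := Finsupp.mem_span_range_iff_exists_finsupp.1 h
  simp only [Finsupp.sum, Finset.sum_apply, Pi.smul_apply, smul_eq_mul]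
  rw [integral_finsetSum _ fun t _ ↦ (hX.hasGaussianLaw_eval t).integrable.const_mul (c t)]
  simp [integral_const_mul, hmean]

/-- An almost sure limit of centered real Gaussian processes is a Gaussian process. -/
theorem IsGaussianProcess.of_tendsto_ae {Y : ℕ → T → Ω → ℝ} {X : T → Ω → ℝ}
    (hY : ∀ m, IsGaussianProcess (Y m) P) (hmean : ∀ m t, P[Y m t] = 0)
    (hlim : ∀ t, ∀ᵐ ω ∂P, Tendsto (fun m ↦ Y m t ω) atTop (𝓝 (X t ω))) :
    IsGaussianProcess X P where
  hasGaussianLaw I := by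
    have hX (t : T) : AEMeasurable (X t) P :=
      aemeasurable_of_tendsto_metrizable_ae' (fun m ↦ (hY m).aemeasurable t) (hlim t)
    have hXI : AEMeasurable (fun ω ↦ I.restrict (X · ω)) P :=
      aemeasurable_pi_lambda _ fun t ↦ hX t
    refine ⟨isGaussian_of_isGaussian_map fun L ↦ ?_⟩
    -- Cramér–Wold: testing against a linear functional `L` reduces the claim to the scalar limit
    -- lemma.
    rw [AEMeasurable.map_map_of_aemeasurable (by fun_prop) hXI]
    refine (exists_hasLaw_gaussianReal_of_tendsto_ae
      (Y := fun m ↦ L ∘ fun ω ↦ I.restrict (Y m · ω)) (Z := L ∘ fun ω ↦ I.restrict (X · ω))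
      (fun m ↦ ((hY m).hasGaussianLaw I).map L) (fun m ↦ ?_) ?_).elim
      fun v hv ↦ hv.2.hasGaussianLaw.isGaussian_map
    · have hint : Integrable (fun ω ↦ I.restrict (Y m · ω)) P :=
        ((hY m).hasGaussianLaw I).integrable
      simp only [Function.comp_def]
      rw [L.integral_comp_comm hint]
      convert! L.map_zero
      ext t
      rw [eval_integral fun t ↦ hint.eval t]
      exact hmean m t
    · filter_upwards [(ae_ball_iff I.countable_toSet).2 fun t _ ↦ hlim t] with ω hω
      refine (L.continuous.tendsto _).comp (tendsto_pi_nhds.2 fun t ↦ hω t t.2)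

/-- Independent real Gaussian processes are jointly Gaussian. -/
theorem iIndepFun.isGaussianProcess {ι : Type*} [Finite ι] {X : ι → T → Ω → ℝ}
    (hindep : iIndepFun (fun i ω t ↦ X i t ω) P) (hX : ∀ i, IsGaussianProcess (X i) P) :
    IsGaussianProcess (fun q : ι × T ↦ X q.1 q.2) P where
  hasGaussianLaw I := by
    classical
    have := Fintype.ofFinite ι
    -- Each process is sampled at all times occurring in `I`; `L` then selects the coordinates
    -- wanted.
    let J : Finset T := I.image Prod.snd
    have h1 : iIndepFun (fun i ω ↦ J.restrict (X i · ω)) P :=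
      hindep.comp (fun _ f ↦ J.restrict f) fun _ ↦ Finset.measurable_restrict J
    have h2 := h1.hasGaussianLaw fun i ↦ (hX i).hasGaussianLaw J
    let L : (ι → J → ℝ) →L[ℝ] I → ℝ :=
      ContinuousLinearMap.pi fun q ↦
        (ContinuousLinearMap.proj (R := ℝ) (φ := fun _ : J ↦ ℝ)
          ⟨q.1.2, Finset.mem_image_of_mem _ q.2⟩).comp
          (ContinuousLinearMap.proj (R := ℝ) (φ := fun _ : ι ↦ J → ℝ) q.1.1)
    exact h2.map L

end GaussianLimit

end ProbabilityTheory

/-! ### The implicit Euler scheme: pathwise convergence and variance -/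

section ImplicitEuler

variable {Ω : Type*} {α ε : ℝ}

/-- The implicit Euler scheme with step `h` for `dX = -α X dt + ε dw`, `X(0) = 0`. -/
noncomputable def implicitEuler (α ε : ℝ) (h : ℝ≥0) (w : ℝ≥0 → Ω → ℝ) : ℕ → Ω → ℝ
  | 0 => 0
  | k + 1 => (1 + α * h)⁻¹ • (implicitEuler α ε h w k + ε • (w ((k + 1 : ℕ) * h) - w (k * h)))

theorem implicitEuler_mem_span (h : ℝ≥0) (w : ℝ≥0 → Ω → ℝ) (k : ℕ) :
    implicitEuler α ε h w k ∈ Submodule.span ℝ (Set.range w) := by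
  induction k with
  | zero => exact Submodule.zero_mem _
  | succ k ih =>
    have hw (t : ℝ≥0) : w t ∈ Submodule.span ℝ (Set.range w) := Submodule.subset_span ⟨t, rfl⟩
    exact Submodule.smul_mem _ _ (Submodule.add_mem _ ih
      (Submodule.smul_mem _ _ (Submodule.sub_mem _ (hw _) (hw _))))

/-- The error of the implicit Euler scheme is at most the modulus of continuity of the solution. -/
theorem abs_sub_implicitEuler_le (hα : 0 < α) {w x : ℝ≥0 → Ω → ℝ} {ω : Ω}
    (hcont : Continuous fun t ↦ x t ω) (h0 : x 0 ω = 0)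
    (hsde : ∀ t : ℝ≥0, x t ω = -α * (∫ s in (0 : ℝ)..(t : ℝ), x s.toNNReal ω) + ε * w t ω)
    {h t : ℝ≥0} {η : ℝ} (hη0 : 0 ≤ η)
    (hη : ∀ a ≤ t, ∀ b ≤ t, dist a b ≤ h → |x a ω - x b ω| ≤ η) (k : ℕ) (hk : k * h ≤ t) :
    |x (k * h) ω - implicitEuler α ε h w k ω| ≤ η := by
  induction k with
  | zero => simpa [implicitEuler, h0] using hη0
  | succ k ih =>
    have hle : (k : ℝ≥0) * h ≤ (k + 1 : ℕ) * h := by gcongr; simp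
    specialize ih (hle.trans hk)
    have hleR : (k : ℝ) * h ≤ (k + 1 : ℕ) * h := by exact_mod_cast hle
    have hc : Continuous fun s : ℝ ↦ x s.toNNReal ω := hcont.comp continuous_real_toNNReal
    have hint (a b : ℝ) : IntervalIntegrable (fun s : ℝ ↦ x s.toNNReal ω) volume a b :=
      hc.intervalIntegrable a b
    -- Local error of replacing the integrand by its right endpoint value.
    set E : ℝ := ∫ s in (k * h : ℝ)..((k + 1 : ℕ) * h : ℝ),
      (x ((k + 1 : ℕ) * h) ω - x s.toNNReal ω) with hE
    have hE_le : |E| ≤ η * h := by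
      have := intervalIntegral.norm_integral_le_of_norm_le_const
        (f := fun s : ℝ ↦ x ((k + 1 : ℕ) * h) ω - x s.toNNReal ω) (C := η)
        (a := (k * h : ℝ)) (b := ((k + 1 : ℕ) * h : ℝ)) fun s hs ↦ by
          rw [Set.uIoc_of_le hleR] at hs
          have hs0 : 0 ≤ s := le_trans (by positivity) hs.1.le
          have hs1 : s.toNNReal ≤ (k + 1 : ℕ) * h := by
            rw [Real.toNNReal_le_iff_le_coe]; exact_mod_cast hs.2
          refine hη _ hk _ (hs1.trans hk) ?_
          rw [NNReal.dist_eq, Real.coe_toNNReal _ hs0, abs_le]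
          have h1 := hs.1
          have h2 := hs.2
          push_cast at h1 h2 ⊢
          constructor <;> nlinarith [h.2]
      refine this.trans_eq ?_
      rw [abs_of_nonneg (by linarith)]
      push_cast; ring
    have hE_eq : ∫ s in (k * h : ℝ)..((k + 1 : ℕ) * h : ℝ), x s.toNNReal ω =
        h * x ((k + 1 : ℕ) * h) ω - E := by
      rw [hE, intervalIntegral.integral_sub (by simp) (hint _ _)]
      simp only [intervalIntegral.integral_const, smul_eq_mul]
      push_cast; ring
    have hsplit := intervalIntegral.integral_add_adjacent_intervals
      (hint 0 (k * h)) (hint (k * h) ((k + 1 : ℕ) * h))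
    have e1 := hsde (k * h)
    have e2 := hsde ((k + 1 : ℕ) * h)
    simp only [NNReal.coe_mul, NNReal.coe_natCast] at e1 e2
    rw [← hsplit, hE_eq] at e2
    have hρ : 0 < 1 + α * h := by positivity
    have hdiff : (x ((k + 1 : ℕ) * h) ω - implicitEuler α ε h w (k + 1) ω) * (1 + α * h) =
        x (k * h) ω - implicitEuler α ε h w k ω + α * E := by
      have : implicitEuler α ε h w (k + 1) ω * (1 + α * h) =
          implicitEuler α ε h w k ω + ε * (w ((k + 1 : ℕ) * h) ω - w (k * h) ω) := by
        simp only [implicitEuler, Pi.smul_apply, Pi.add_apply, Pi.sub_apply, smul_eq_mul]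
        field_simp
      rw [sub_mul, this]
      linarith
    -- The implicit factor `1 + α * h` absorbs the local error exactly, so the bound `η` does not
    -- grow with `k` and no Gronwall argument is needed.
    rw [← mul_le_mul_iff_left₀ hρ, ← abs_of_pos hρ, ← abs_mul, abs_of_pos hρ, hdiff]
    calc _ ≤ |x (k * h) ω - implicitEuler α ε h w k ω| + |α * E| := abs_add_le _ _
      _ ≤ η + α * (η * h) := by rw [abs_mul, abs_of_pos hα]; gcongr
      _ = η * (1 + α * h) := by ring

/-- The implicit Euler scheme converges pathwise. -/
theorem tendsto_implicitEuler (hα : 0 < α) {w x : ℝ≥0 → Ω → ℝ} {ω : Ω}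
    (hcont : Continuous fun t ↦ x t ω) (h0 : x 0 ω = 0)
    (hsde : ∀ t : ℝ≥0, x t ω = -α * (∫ s in (0 : ℝ)..(t : ℝ), x s.toNNReal ω) + ε * w t ω)
    (t : ℝ≥0) :
    Tendsto (fun m : ℕ ↦ implicitEuler α ε (t / (m + 1 : ℕ)) w (m + 1) ω) atTop (𝓝 (x t ω)) := by
  rw [Metric.tendsto_atTop']
  intro η hη
  have hunif := (isCompact_Icc (a := 0) (b := t)).uniformContinuousOn_of_continuous
    hcont.continuousOn
  obtain ⟨δ, hδ, hmod⟩ := Metric.uniformContinuousOn_iff.1 hunif (η / 2) (half_pos hη)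
  have hstep : Tendsto (fun m : ℕ ↦ (t : ℝ) / ((m : ℝ) + 1)) atTop (𝓝 0) :=
    tendsto_const_div_atTop_nhds_zero_nat (t : ℝ) |>.comp (tendsto_add_atTop_nat 1) |>.congr
      fun m ↦ by simp
  obtain ⟨N, hN⟩ := eventually_atTop.1 (hstep.eventually_lt_const hδ)
  refine ⟨N, fun m hm ↦ ?_⟩
  have heq : ((m + 1 : ℕ) : ℝ≥0) * (t / (m + 1 : ℕ)) = t :=
    mul_div_cancel₀ _ (by positivity)
  have h := abs_sub_implicitEuler_le hα hcont h0 hsde (h := t / (m + 1 : ℕ)) (t := t)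
    (half_pos hη).le (fun a ha b hb hab ↦ (hmod a ⟨zero_le, ha⟩ b ⟨zero_le, hb⟩ <|
      hab.trans_lt (by simpa using hN m hm.le)).le) (m + 1) heq.le
  rw [heq] at h
  rw [dist_comm, Real.dist_eq]
  linarith

variable [MeasurableSpace Ω] {P : Measure Ω} {w : ℝ≥0 → Ω → ℝ}

theorem ProbabilityTheory.IsPreBrownianReal.memLp_implicitEuler (hw : IsPreBrownianReal w P)
    (h : ℝ≥0) (k : ℕ) : MemLp (implicitEuler α ε h w k) 2 P :=
  ((hw.isGaussianProcess.of_mem_span fun k ↦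
    implicitEuler_mem_span h w k).hasGaussianLaw_eval k).memLp_two

/-- The scheme at step `k` is uncorrelated with the later increments of the noise. -/
theorem ProbabilityTheory.IsPreBrownianReal.covariance_implicitEuler (hw : IsPreBrownianReal w P)
    (h : ℝ≥0) (k : ℕ) {t u : ℝ≥0} (ht : k * h ≤ t) (hu : k * h ≤ u) :
    cov[implicitEuler α ε h w k, w t; P] = cov[implicitEuler α ε h w k, w u; P] := by
  have := hw.isGaussianProcess.isProbabilityMeasure
  have hL (s : ℝ≥0) : MemLp (w s) 2 P := (hw.isGaussianProcess.hasGaussianLaw_eval s).memLp_two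
  induction k with
  | zero => simp [implicitEuler]
  | succ k ih =>
    have hle : (k : ℝ≥0) * h ≤ (k + 1 : ℕ) * h := by gcongr; simp
    have hinc (s : ℝ≥0) (hs : ((k + 1 : ℕ) : ℝ≥0) * h ≤ s) :
        cov[w ((k + 1 : ℕ) * h) - w (k * h), w s; P] = ((k + 1 : ℕ) * h : ℝ≥0) - (k * h : ℝ≥0) := by
      rw [covariance_sub_left (hL _) (hL _) (hL _), hw.covariance_eval, hw.covariance_eval,
        min_eq_left hs, min_eq_left (hle.trans hs)]
    have hstep (s : ℝ≥0) := covariance_add_left (hw.memLp_implicitEuler (α := α) (ε := ε) h k)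
      (((hL ((k + 1 : ℕ) * h)).sub (hL (k * h))).const_smul ε) (hL s)
    rw [implicitEuler, covariance_smul_left, covariance_smul_left, hstep, hstep,
      covariance_smul_left, covariance_smul_left, hinc t ht, hinc u hu,
      ih (hle.trans ht) (hle.trans hu)]

/-- The variance of the scheme is at most the stationary variance of the Ornstein-Uhlenbeck
process. -/
theorem ProbabilityTheory.IsPreBrownianReal.variance_implicitEuler_le
    (hw : IsPreBrownianReal w P) (hα : 0 < α) (h : ℝ≥0) (k : ℕ) :
    Var[implicitEuler α ε h w k; P] ≤ ε ^ 2 / (2 * α) := by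
  have := hw.isGaussianProcess.isProbabilityMeasure
  have hL (s : ℝ≥0) : MemLp (w s) 2 P := (hw.isGaussianProcess.hasGaussianLaw_eval s).memLp_two
  induction k with
  | zero => simp only [implicitEuler, variance_zero]; positivity
  | succ k ih =>
    have hle : (k : ℝ≥0) * h ≤ (k + 1 : ℕ) * h := by gcongr; simp
    have hY := hw.memLp_implicitEuler (α := α) (ε := ε) h k
    have hvar : Var[w ((k + 1 : ℕ) * h) - w (k * h); P] = h := by
      rw [(hw.hasLaw_sub _ _).variance_eq, variance_id_gaussianReal, coe_nndist]
      change dist ((k + 1 : ℕ) * (h : ℝ)) (k * h) = h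
      rw [Real.dist_eq, ← sub_mul, Nat.cast_succ, add_sub_cancel_left, one_mul,
        abs_of_nonneg h.coe_nonneg]
    rw [implicitEuler, variance_smul, variance_add hY (((hL _).sub (hL _)).const_smul ε),
      covariance_smul_right, covariance_sub_right hY (hL _) (hL _),
      hw.covariance_implicitEuler h k hle le_rfl, variance_smul, hvar]
    have hρ : 0 < 1 + α * h := by positivity
    rw [inv_pow, inv_mul_le_iff₀ (by positivity)]
    -- With `v = ε² / (2α)`, the recursion gives `v + 2αh v ≤ v (1 + αh)²`, with slack `v (αh)²`.
    have : ε ^ 2 * h = ε ^ 2 / (2 * α) * (2 * α * h) := by field_simp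
    nlinarith [show 0 ≤ ε ^ 2 / (2 * α) * (α * h) ^ 2 by positivity]

end ImplicitEuler

/-! ### Uniform moment bounds for Gaussian families -/

section Moments

variable {Ω T : Type*} [MeasurableSpace Ω] {P : Measure Ω}

/-- If `Y t` is centered Gaussian with bounded variances and `r` is bounded, then `exp (r + Y)` is
`L^p`-bounded. -/
theorem isLpBounded_exp_add {Y : T → Ω → ℝ} {p C R : ℝ} (hp : 0 < p)
    (hY : ∀ t, HasGaussianLaw (Y t) P) (hmean : ∀ t, P[Y t] = 0) (hvar : ∀ t, Var[Y t; P] ≤ C)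
    {r : T → ℝ} (hr : ∀ t, |r t| ≤ R) :
    IsLpBounded (fun t ω ↦ Real.exp (r t + Y t ω)) (ENNReal.ofReal p) P := by
  -- The constant comes from `E[exp (p Y)] = exp (p² Var[Y] / 2)`.
  refine ⟨fun t ↦ ?_, (ENNReal.ofReal (Real.exp (p * R + C * p ^ 2 / 2)) ^ (1 / p)).toNNReal,
    fun t ↦ ?_⟩
  · have := (hY t).aemeasurable
    exact AEMeasurable.aestronglyMeasurable (by fun_prop)
  have hlaw : P.map (Y t) = gaussianReal 0 Var[Y t; P].toNNReal := by
    rw [(hY t).map_eq_gaussianReal, hmean]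
  have hmgf := mgf_gaussianReal hlaw p
  have hint : Integrable (fun ω ↦ Real.exp (p * Y t ω)) P := by
    have h := integrable_exp_mul_gaussianReal (μ := 0) (v := Var[Y t; P].toNNReal) p
    rw [← hlaw] at h
    exact h.comp_aemeasurable (hY t).aemeasurable
  rw [ENNReal.coe_toNNReal (ENNReal.rpow_ne_top_of_nonneg (by positivity) ENNReal.ofReal_ne_top),
    eLpNorm_eq_lintegral_rpow_enorm_toReal (by simpa using hp) ENNReal.ofReal_ne_top,
    ENNReal.toReal_ofReal hp.le]
  gcongr
  have hpow (ω : Ω) : ‖Real.exp (r t + Y t ω)‖ₑ ^ p =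
      ENNReal.ofReal (Real.exp (p * r t) * Real.exp (p * Y t ω)) := by
    rw [Real.enorm_of_nonneg (Real.exp_pos _).le,
      ENNReal.ofReal_rpow_of_nonneg (Real.exp_pos _).le hp.le, ← Real.exp_mul, ← Real.exp_add]
    ring_nf
  simp_rw [hpow]
  rw [← ofReal_integral_eq_lintegral_ofReal (hint.const_mul _)
    (ae_of_all _ fun ω ↦ by positivity), integral_const_mul]
  change ENNReal.ofReal (_ * mgf (Y t) P p) ≤ _
  rw [hmgf, ← Real.exp_add, Real.coe_toNNReal _ (variance_nonneg _ _)]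
  have h1 := (abs_le.1 (hr t)).2
  have h2 := hvar t
  rw [zero_mul, zero_add]
  gcongr

/-- Centered Gaussian variables with bounded variances are `L^p`-bounded. -/
theorem isLpBounded_of_hasGaussianLaw {Y : T → Ω → ℝ} {p C : ℝ} (hp : 1 ≤ p)
    (hY : ∀ t, HasGaussianLaw (Y t) P) (hmean : ∀ t, P[Y t] = 0) (hvar : ∀ t, Var[Y t; P] ≤ C) :
    IsLpBounded Y (ENNReal.ofReal p) P := by
  have hp0 := zero_lt_one.trans_le hp
  -- The bound `|y| ≤ exp y + exp (-y)` reduces the claim to exponentials.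
  obtain ⟨h1, C1, hC1⟩ := isLpBounded_exp_add hp0 hY hmean hvar (r := 0) (R := 0) (by simp)
  obtain ⟨h2, C2, hC2⟩ := isLpBounded_exp_add hp0 (Y := fun t ↦ -Y t) (fun t ↦ (hY t).neg)
    (fun t ↦ by simp [integral_neg, hmean]) (fun t ↦ by rw [variance_neg]; exact hvar t)
    (r := 0) (R := 0) (by simp)
  refine ⟨fun t ↦ (hY t).aemeasurable.aestronglyMeasurable, C1 + C2, fun t ↦ ?_⟩
  refine (eLpNorm_mono_real fun ω ↦ ?_).trans ((eLpNorm_add_le (h1 t) (h2 t) ?_).trans ?_)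
  · simp only [Pi.zero_apply, zero_add, Pi.add_apply, Pi.neg_apply, Real.norm_eq_abs]
    have a1 := Real.add_one_le_exp (Y t ω)
    have a2 := Real.add_one_le_exp (-Y t ω)
    have b1 := Real.exp_pos (Y t ω)
    have b2 := Real.exp_pos (-Y t ω)
    exact abs_le.2 ⟨by linarith, by linarith⟩
  · simpa using hp
  · push_cast
    exact add_le_add (hC1 t) (hC2 t)

/-- Parallelogram identity with `Var[X + Y] ≥ 0`; independence plays no role, so equal nodes need no
separate case. -/
theorem ProbabilityTheory.variance_sub_le_two_mul [IsFiniteMeasure P] {X Y : Ω → ℝ}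
    (hX : MemLp X 2 P) (hY : MemLp Y 2 P) : Var[X - Y; P] ≤ 2 * (Var[X; P] + Var[Y; P]) := by
  have h := variance_nonneg (X + Y) P
  rw [variance_add hX hY] at h
  rw [variance_sub hX hY]
  linarith

end Moments

/-! ### Ornstein–Uhlenbeck processes as limits of the scheme -/

section OrnsteinUhlenbeck

variable {Ω ι : Type*} [MeasurableSpace Ω] {P : Measure Ω} {α : ℝ}

theorem IsOrnsteinUhlenbeck.tendsto_implicitEuler {ε : ℝ} {W X : ℝ≥0 → Ω → ℝ}
    (hX : IsOrnsteinUhlenbeck α ε W X P) (hα : 0 < α) (t : ℝ≥0) :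
    ∀ᵐ ω ∂P, Tendsto (fun m : ℕ ↦ implicitEuler α ε (t / (m + 1 : ℕ)) W (m + 1) ω) atTop
      (𝓝 (X t ω)) := by
  filter_upwards [hX.cont, hX.init, hX.sde] with ω h1 h2 h3
  exact _root_.tendsto_implicitEuler hα h1 h2 h3 t

/-- Ornstein-Uhlenbeck processes driven by independent Brownian motions are jointly Gaussian. -/
theorem isGaussianProcess_of_isOrnsteinUhlenbeck [Finite ι] (hα : 0 < α) {ε : ι → ℝ}
    {W X : ι → ℝ≥0 → Ω → ℝ} (hW : ∀ i, IsPreBrownianReal (W i) P)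
    (hindep : iIndepFun (fun i ω t ↦ W i t ω) P)
    (hX : ∀ i, IsOrnsteinUhlenbeck α (ε i) (W i) (X i) P) :
    IsGaussianProcess (fun q : ι × ℝ≥0 ↦ X q.1 q.2) P := by
  have hG := hindep.isGaussianProcess fun i ↦ IsPreBrownianReal.isGaussianProcess (hW i)
  have hmem (m : ℕ) (q : ι × ℝ≥0) :
      implicitEuler α (ε q.1) (q.2 / (m + 1 : ℕ)) (W q.1) (m + 1) ∈
        Submodule.span ℝ (Set.range fun q : ι × ℝ≥0 ↦ W q.1 q.2) := by
    refine Submodule.span_mono ?_ (implicitEuler_mem_span _ _ _)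
    rintro _ ⟨t, rfl⟩
    exact ⟨(q.1, t), rfl⟩
  exact .of_tendsto_ae (fun m ↦ hG.of_mem_span (hmem m))
    (fun m q ↦ hG.integral_eq_zero_of_mem_span (fun q ↦ (hW q.1).integral_eval q.2) (hmem m q))
    fun q ↦ (hX q.1).tendsto_implicitEuler hα q.2

/-- The Ornstein-Uhlenbeck process is centered and its variance is at most `ε² / (2α)`. -/
theorem IsOrnsteinUhlenbeck.integral_eq_zero_and_variance_le {ε : ℝ} {W X : ℝ≥0 → Ω → ℝ}
    (hX : IsOrnsteinUhlenbeck α ε W X P) (hα : 0 < α) (hW : IsPreBrownianReal W P) (t : ℝ≥0) :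
    P[X t] = 0 ∧ Var[X t; P] ≤ ε ^ 2 / (2 * α) := by
  obtain ⟨v, hv, hlaw⟩ := exists_hasLaw_gaussianReal_of_tendsto_ae
    (fun m ↦ (hW.isGaussianProcess.of_mem_span fun m : ℕ ↦ implicitEuler_mem_span
      (t / (m + 1 : ℕ)) W (m + 1)).hasGaussianLaw_eval m)
    (fun m ↦ hW.isGaussianProcess.integral_eq_zero_of_mem_span hW.integral_eval
      (implicitEuler_mem_span _ W _)) (hX.tendsto_implicitEuler hα t)
  refine ⟨by rw [hlaw.integral_eq, integral_id_gaussianReal], ?_⟩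
  rw [hlaw.variance_eq, variance_id_gaussianReal]
  exact le_of_tendsto' hv fun m ↦ hW.variance_implicitEuler_le hα _ _

end OrnsteinUhlenbeck

/-! ### Skews and relative skews -/

section Skew

variable {Ω : Type*} {n : ℕ}

theorem nodeState_mem_span (X : Fin n → ℝ≥0 → Ω → ℝ) (i : Fin (n + 1)) (t : ℝ≥0) :
    nodeState X i t ∈ Submodule.span ℝ (Set.range fun q : Fin n × ℝ≥0 ↦ X q.1 q.2) := by
  induction i using Fin.cases with
  | zero => exact Submodule.zero_mem _
  | succ i => exact Submodule.subset_span ⟨(i, t), rfl⟩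

theorem relState_mem_span (X : Fin n → ℝ≥0 → Ω → ℝ) (i j : Fin (n + 1)) (t : ℝ≥0) :
    relState X i j t ∈ Submodule.span ℝ (Set.range fun q : Fin n × ℝ≥0 ↦ X q.1 q.2) :=
  Submodule.sub_mem _ (nodeState_mem_span X j t) (nodeState_mem_span X i t)

theorem relState_zero_left (X : Fin n → ℝ≥0 → Ω → ℝ) (i : Fin (n + 1)) :
    relState X 0 i = nodeState X i := by
  ext t ω
  simp [relState, nodeState]

variable (α : ℝ) (ε : Fin n → ℝ) (X : Fin n → ℝ≥0 → Ω → ℝ)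

theorem skew_zero (t : ℝ≥0) (ω : Ω) : skew α ε X 0 t ω = 1 := by
  simp [skew, skewCoeff, nodeNoise, nodeState]

theorem relSkew_zero_left (i : Fin (n + 1)) : relSkew α ε X 0 i = skew α ε X i := by
  ext t ω
  simp [relSkew, skew_zero]

theorem one_div_relSkew (i j : Fin (n + 1)) (t : ℝ≥0) (ω : Ω) :
    1 / relSkew α ε X i j t ω = relSkew α ε X j i t ω := by
  simp [relSkew]

theorem relSkew_eq_exp (i j : Fin (n + 1)) (t : ℝ≥0) (ω : Ω) :
    relSkew α ε X i j t ω =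
      Real.exp (Real.log (skewCoeff α ε j t) - Real.log (skewCoeff α ε i t) +
        relState X i j t ω) := by
  simp only [relSkew, skew, skewCoeff, relState, Real.log_exp]
  rw [← Real.exp_add, ← Real.exp_add, ← Real.exp_sub]
  ring_nf

variable {α}

/-- The factor `1 - exp (-2αt)` stays in `[0, 1]`, which keeps the deterministic part of the
exponent bounded in time. -/
theorem abs_log_skewCoeff_le (hα : 0 < α) (i : Fin (n + 1)) (t : ℝ≥0) :
    |Real.log (skewCoeff α ε i t)| ≤ 1 / 4 * (nodeNoise ε i ^ 2 / α) := by
  have h1 : Real.exp (-2 * α * t) ≤ 1 := Real.exp_le_one_iff.2 (by nlinarith [t.coe_nonneg])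
  have h2 := Real.exp_pos (-2 * α * t)
  rw [skewCoeff, Real.log_exp, abs_mul, abs_of_nonneg (sub_nonneg.2 h1), neg_mul, abs_neg,
    abs_of_nonneg (by positivity)]
  exact mul_le_of_le_one_right (by positivity) (by linarith)

variable {ε X} [MeasurableSpace Ω] {P : Measure Ω}

theorem variance_nodeState_le (hα : 0 < α) {W : Fin n → ℝ≥0 → Ω → ℝ}
    (hW : ∀ i, IsPreBrownianReal (W i) P)
    (hX : ∀ i, IsOrnsteinUhlenbeck α (ε i) (W i) (X i) P) (i : Fin (n + 1)) (t : ℝ≥0) :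
    Var[nodeState X i t; P] ≤ nodeNoise ε i ^ 2 / (2 * α) := by
  induction i using Fin.cases with
  | zero =>
    have : nodeState X 0 t = 0 := rfl
    rw [this, variance_zero]
    positivity
  | succ i => exact ((hX i).integral_eq_zero_and_variance_le hα (hW i) t).2

theorem isLpBounded_relState_relSkew (hα : 0 < α) {W : Fin n → ℝ≥0 → Ω → ℝ}
    (hW : ∀ i, IsPreBrownianReal (W i) P)
    (hindep : iIndepFun (fun i ω t ↦ W i t ω) P)
    (hX : ∀ i, IsOrnsteinUhlenbeck α (ε i) (W i) (X i) P) {p : ℝ} (hp : 1 ≤ p)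
    (i j : Fin (n + 1)) :
    IsGaussianProcess (relState X i j) P ∧
      IsLpBounded (relState X i j) (ENNReal.ofReal p) P ∧
      IsLpBounded (relSkew α ε X i j) (ENNReal.ofReal p) P := by
  have hG := isGaussianProcess_of_isOrnsteinUhlenbeck hα hW hindep hX
  have := hG.isProbabilityMeasure
  have hrel := hG.of_mem_span (relState_mem_span X i j)
  have hmean (t : ℝ≥0) : P[relState X i j t] = 0 := hG.integral_eq_zero_of_mem_span
    (fun q ↦ ((hX q.1).integral_eq_zero_and_variance_le hα (hW q.1) q.2).1)
    (relState_mem_span X i j t)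
  have hL (i : Fin (n + 1)) (t : ℝ≥0) : MemLp (nodeState X i t) 2 P :=
    ((hG.of_mem_span (nodeState_mem_span X i)).hasGaussianLaw_eval t).memLp_two
  have hvar (t : ℝ≥0) : Var[relState X i j t; P] ≤
      2 * (nodeNoise ε j ^ 2 / (2 * α) + nodeNoise ε i ^ 2 / (2 * α)) := by
    refine (variance_sub_le_two_mul (hL j t) (hL i t)).trans ?_
    gcongr <;> exact variance_nodeState_le hα hW hX _ t
  refine ⟨hrel, isLpBounded_of_hasGaussianLaw hp hrel.hasGaussianLaw_eval hmean hvar, ?_⟩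
  convert! isLpBounded_exp_add (zero_lt_one.trans_le hp) hrel.hasGaussianLaw_eval hmean hvar
    (r := fun t ↦ Real.log (skewCoeff α ε j t) - Real.log (skewCoeff α ε i t))
    (fun t ↦ (abs_sub _ _).trans
      (add_le_add (abs_log_skewCoeff_le ε hα j t) (abs_log_skewCoeff_le ε hα i t))) using 1
  ext t ω
  exact relSkew_eq_exp α ε X i j t ω

end Skew

theorem mainTheorem8 {Ω : Type*} [MeasurableSpace Ω] (P : Measure Ω) [IsProbabilityMeasure P]
    (n : ℕ) (α : ℝ) (hα : 0 < α) (ε : Fin n → ℝ) (hε : ∀ i, 0 < ε i)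
    (W X : Fin n → ℝ≥0 → Ω → ℝ)
    (hW : ∀ i, IsBrownianReal (W i) P)
    (hindep : iIndepFun (fun (i : Fin n) (ω : Ω) (t : ℝ≥0) => W i t ω) P)
    (hX : ∀ i, IsOrnsteinUhlenbeck α (ε i) (W i) (X i) P)
    (p : ℝ) (hp : 1 ≤ p) :
    (∀ i : Fin (n + 1),
      IsGaussianProcess (nodeState X i) P ∧
      IsLpBounded (nodeState X i) (ENNReal.ofReal p) P ∧
      IsLpBounded (skew α ε X i) (ENNReal.ofReal p) P ∧
      IsLpBounded (fun t ω => 1 / skew α ε X i t ω) (ENNReal.ofReal p) P) ∧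
    (∀ i j : Fin (n + 1),
      IsGaussianProcess (relState X i j) P ∧
      IsLpBounded (relState X i j) (ENNReal.ofReal p) P ∧
      IsLpBounded (relSkew α ε X i j) (ENNReal.ofReal p) P ∧
      IsLpBounded (fun t ω => 1 / relSkew α ε X i j t ω) (ENNReal.ofReal p) P) := by
  have key : ∀ i j : Fin (n + 1),
      IsGaussianProcess (relState X i j) P ∧
      IsLpBounded (relState X i j) (ENNReal.ofReal p) P ∧
      IsLpBounded (relSkew α ε X i j) (ENNReal.ofReal p) P ∧
      IsLpBounded (fun t ω => 1 / relSkew α ε X i j t ω) (ENNReal.ofReal p) P := by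
    intro i j
    have h (i j : Fin (n + 1)) := isLpBounded_relState_relSkew hα
      (fun i ↦ (hW i).toIsPreBrownianReal) hindep hX hp i j
    simp_rw [one_div_relSkew]
    exact ⟨(h i j).1, (h i j).2.1, (h i j).2.2, (h j i).2.2⟩
  refine ⟨fun i ↦ ?_, key⟩
  simpa only [relState_zero_left, relSkew_zero_left] using key 0 i
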